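/- Let $d\ge 1$ and let $\pi$ be the Euclidean projection onto the simplex $\mathbb S^{d-1}_+=\{x\in[0,\infty)^d: x_1+\dots+x_d=1\}$. Write $|\cdot|$ for the $\ell^1$-norm on $\mathbb R^d$ and, for nonempty $\beta\subset\{1,\dots,d\}$, let $C_\beta=\{x\in\mathbb S^{d-1}_+: x_i>0 \text{ for } i\in\beta,\ x_i=0\text{ for } i\notin\beta\}$. Let $X$ be a random vector in $[0,\infty)^d$ that is sparsely regularly varying: there are a tail index $\alpha>0$, a random variable $Y$ with $\mathbb P(Y>y)=y^{-\alpha}$ for $y>1$, and a random vector $Z$ in $\mathbb S^{d-1}_+$, such that the conditional law of $(|X|/t,\pi(X/t))$ given $|X|>t$ converges weakly to the law of $(Y,Z)$ as $t\to\infty$. Let $X_1,X_2,\dots$ be i.i.d. with the law of $X$, let $(u_n)$ be a sequence of positive numbers, and set $$k_n=n\,\mathbb P(|X|>u_n),\quad p_n(\beta)=\mathbb P(\pi(X/u_n)\in C_\beta\mid |X|>u_n),\quad p^*(\beta)=\mathbb P(Z\in C_\beta),$$ $$T_n(\beta)=\sum_{j=1}^n \mathbf 1\{\pi(X_j/u_n)\in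 C_\beta,\ |X_j|>u_n\}.$$ Let $\mathcal S^\infty=\{\beta\neq\emptyset: k_np_n(\beta)\to\infty\}$ and $\mathcal S^*(Z)=\{\beta\neq\emptyset: p^*(\beta)>0\}$, with cardinalities $s_\infty$ and $s^*$. A subscript $\mathcal S$ denotes the restriction of a vector indexed by the nonempty $\beta$ to $\beta\in\mathcal S$, and powers of diagonal matrices are taken componentwise. Assume $u_n\to\infty$ and $k_n\to\infty$. Then, as $n\to\infty$: 1. $\sqrt{k_n}\,\mathrm{Diag}(p_{n,\mathcal S^\infty})^{-1/2}\big(T_{n,\mathcal S^\infty}/k_n-p_{n,\mathcal S^\infty}\big)\to\mathcal N(0,\mathrm{Id}_{s_\infty})$ in distribution. 2. $\sqrt{k_n}\,\mathrm{Diag}(p^*_{\mathcal S^*(Z)})^{-1/2}\big(T_{n,\mathcal S^*(Z)}/k_n-p_{n,\mathcal S^*(Z)}\big)\to\mathcal N(0,\mathrm{Id}_{s^*})$ in distribution. 3. If moreover $\sqrt{k_n}\,(p_n(\beta)-p^*(\beta))\to0$ for every $\beta\in\mathcal S^*(Z)$, then $\sqrt{k_n}\,\mathrm{Diag}(p^*_{\mathcal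 S^*(Z)})^{-1/2}\big(T_{n,\mathcal S^*(Z)}/k_n-p^*_{\mathcal S^*(Z)}\big)\to\mathcal N(0,\mathrm{Id}_{s^*})$ in distribution. -/

import Mathlib

open MeasureTheory ProbabilityTheory Filter Topology
open scoped BoundedContinuousFunction

namespace SparseRV

/-- The `ℓ¹`-norm `|x| = ∑ i, |x i|` on `ℝ^d`. -/
def l1Norm {d : ℕ} (x : EuclideanSpace ℝ (Fin d)) : ℝ := ∑ i, |x i|

/-- The probability simplex of `ℝ^d`, as a subset of Euclidean space. -/
def simplex (d : ℕ) : Set (EuclideanSpace ℝ (Fin d)) :=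
  {x | (∀ i, 0 ≤ x i) ∧ ∑ i, x i = 1}

/-- `y` is a point of the simplex at minimal Euclidean distance from `x`. -/
def IsSimplexProj {d : ℕ} (x y : EuclideanSpace ℝ (Fin d)) : Prop :=
  y ∈ simplex d ∧ ∀ z ∈ simplex d, ‖x - y‖ ≤ ‖x - z‖

lemma convex_simplex (d : ℕ) : Convex ℝ (simplex d) := by
  intro x hx y hy a b ha hb hab
  refine ⟨fun i => ?_, ?_⟩
  · have h1 := mul_nonneg ha (hx.1 i)
    have h2 := mul_nonneg hb (hy.1 i)
    simpa using add_nonneg h1 h2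
  · simp [Finset.sum_add_distrib, ← Finset.mul_sum, hx.2, hy.2, hab]

lemma isClosed_simplex (d : ℕ) : IsClosed (simplex d) := by
  have h : simplex d = (⋂ i, {x : EuclideanSpace ℝ (Fin d) | 0 ≤ x i}) ∩
      {x | ∑ i, x i = 1} := by
    ext x; simp [simplex]
  rw [h]
  refine (isClosed_iInter fun i => ?_).inter ?_
  · exact isClosed_le continuous_const (by fun_prop)
  · exact isClosed_eq (by fun_prop) continuous_const

lemma simplex_nonempty {d : ℕ} (hd : 0 < d) : (simplex d).Nonempty := by
  refine ⟨EuclideanSpace.single (⟨0, hd⟩ : Fin d) (1 : ℝ), fun i => ?_, ?_⟩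
  · by_cases h : i = ⟨0, hd⟩ <;> simp [h]
  · simp

/-- For `d ≥ 1`, every point has exactly one nearest point in the simplex. -/
theorem existsUnique_isSimplexProj {d : ℕ} (hd : 0 < d) (x : EuclideanSpace ℝ (Fin d)) :
    ∃! y, IsSimplexProj x y := by
  have hne := simplex_nonempty hd
  have hiff : ∀ y ∈ simplex d, IsSimplexProj x y ↔ ‖x - y‖ = ⨅ w : simplex d, ‖x - w‖ := by
    intro y hy
    have : Nonempty (simplex d) := hne.to_subtype
    have hb : BddBelow (Set.range fun w : simplex d => ‖x - w‖) :=
      ⟨0, Set.forall_mem_range.2 fun _ => norm_nonneg _⟩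
    constructor
    · intro h
      exact le_antisymm (le_ciInf fun w => h.2 w w.2) (ciInf_le hb ⟨y, hy⟩)
    · intro h
      exact ⟨hy, fun z hz => h ▸ ciInf_le hb ⟨z, hz⟩⟩
  obtain ⟨y, hy, hmin⟩ := exists_norm_eq_iInf_of_complete_convex hne
    (isClosed_simplex d).isComplete (convex_simplex d) x
  refine ⟨y, (hiff y hy).2 hmin, fun z hz => ?_⟩
  have h1 := (norm_eq_iInf_iff_real_inner_le_zero (convex_simplex d) hy).1 hmin z hz.1
  have h2 := (norm_eq_iInf_iff_real_inner_le_zero (convex_simplex d) hz.1).1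
    ((hiff z hz.1).1 hz) y hy
  have h3 : inner ℝ (z - y) (z - y) ≤ 0 := by
    have e : inner ℝ (z - y) (z - y) = inner ℝ (x - y) (z - y) + inner ℝ (x - z) (y - z) := by
      rw [← neg_sub z y, inner_neg_right, ← sub_eq_add_neg, ← inner_sub_left]
      congr 1
      abel
    rw [e]; linarith
  rw [real_inner_self_eq_norm_sq] at h3
  exact sub_eq_zero.1 (norm_eq_zero.1 (pow_eq_zero_iff two_ne_zero |>.1
    (le_antisymm h3 (sq_nonneg _))))

open Classical in
/-- The Euclidean projection `π` onto the simplex: the unique nearest point of the simplex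
(the value in dimension `0`, where the simplex is empty, is a placeholder). -/
noncomputable def simplexProj {d : ℕ} (x : EuclideanSpace ℝ (Fin d)) :
    EuclideanSpace ℝ (Fin d) :=
  if h : ∃ y, IsSimplexProj x y then h.choose else 0

theorem simplexProj_spec {d : ℕ} (hd : 0 < d) (x : EuclideanSpace ℝ (Fin d)) :
    IsSimplexProj x (simplexProj x) := by
  have h := (existsUnique_isSimplexProj hd x).exists
  rw [simplexProj, dif_pos h]
  exact h.choose_spec

/-- The subset `C_β` of the simplex: `x i > 0` for `i ∈ β` and `x i = 0` for `i ∉ β`. -/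
def cone {d : ℕ} (β : Finset (Fin d)) : Set (EuclideanSpace ℝ (Fin d)) :=
  {x | x ∈ simplex d ∧ (∀ i ∈ β, 0 < x i) ∧ ∀ i ∉ β, x i = 0}

/-- `X` is sparsely regularly varying with tail index `α`, and with limit `(Y, Z)`:
`Y` has the Pareto distribution `P(Y > y) = y ^ (-α)`, `y > 1`, the vector `Z` takes its values
in the simplex, and the conditional law of `(|X| / t, π (X / t))` given `|X| > t` converges
weakly, as `t → ∞`, to the law of `(Y, Z)`. -/
structure IsSparselyRegularlyVarying {d : ℕ} {Ω Ω' : Type*} [MeasurableSpace Ω]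
    [MeasurableSpace Ω'] (P : Measure Ω) (X : Ω → EuclideanSpace ℝ (Fin d))
    (Q : Measure Ω') (Y : Ω' → ℝ) (Z : Ω' → EuclideanSpace ℝ (Fin d)) (α : ℝ) : Prop where
  index_pos : 0 < α
  measurable_radial : Measurable Y
  measurable_angular : Measurable Z
  pareto : ∀ y : ℝ, 1 < y → Q.real {ω | y < Y ω} = y ^ (-α)
  angular_mem : ∀ᵐ ω ∂Q, Z ω ∈ simplex d
  tendsto : ∀ f : (ℝ × EuclideanSpace ℝ (Fin d)) →ᵇ ℝ,
    Tendsto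
      (fun t : ℝ => ∫ ω, f (l1Norm (X ω) / t, simplexProj (t⁻¹ • X ω))
        ∂(P[|{ω | t < l1Norm (X ω)}]))
      atTop (𝓝 (∫ ω, f (Y ω, Z ω) ∂Q))

/-- `p*(β) = P(Z ∈ C_β)`. -/
noncomputable def pStar {d : ℕ} {Ω' : Type*} [MeasurableSpace Ω'] (Q : Measure Ω')
    (Z : Ω' → EuclideanSpace ℝ (Fin d)) (β : Finset (Fin d)) : ℝ :=
  Q.real {ω | Z ω ∈ cone β}

/-- The pre-asymptotic probability `P(π (X / u) ∈ C_β | |X| > u)`. -/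
noncomputable def pPre {d : ℕ} {Ω : Type*} [MeasurableSpace Ω] (P : Measure Ω)
    (X : Ω → EuclideanSpace ℝ (Fin d)) (u : ℝ) (β : Finset (Fin d)) : ℝ :=
  (P[|{ω | u < l1Norm (X ω)}]).real {ω | simplexProj (u⁻¹ • X ω) ∈ cone β}

/-- The level `n P(|X| > u)`. -/
noncomputable def level {d : ℕ} {Ω : Type*} [MeasurableSpace Ω] (P : Measure Ω)
    (X : Ω → EuclideanSpace ℝ (Fin d)) (n : ℕ) (u : ℝ) : ℝ :=
  n * P.real {ω | u < l1Norm (X ω)}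

open Classical in
/-- The number of indices `j` among the first `n` such that `π (X_j / u) ∈ C_β` and `|X_j| > u`.
The sample is indexed from `0`. -/
noncomputable def clusterCount {d : ℕ} {Ω : Type*}
    (Xs : ℕ → Ω → EuclideanSpace ℝ (Fin d)) (n : ℕ) (u : ℝ) (β : Finset (Fin d)) (ω : Ω) : ℕ :=
  ((Finset.range n).filter fun j =>
    simplexProj (u⁻¹ • Xs j ω) ∈ cone β ∧ u < l1Norm (Xs j ω)).card

open Classical in
/-- The set `S*(Z)` of extremal clusters: nonempty `β` with `p*(β) > 0`. -/
noncomputable def extremalClusters {d : ℕ} {Ω' : Type*} [MeasurableSpace Ω'] (Q : Measure Ω')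
    (Z : Ω' → EuclideanSpace ℝ (Fin d)) : Finset (Finset (Fin d)) :=
  Finset.univ.filter fun β => β.Nonempty ∧ 0 < pStar Q Z β

open Classical in
/-- The set of nonempty clusters `β` with `k_n p_n(β) → ∞`. -/
noncomputable def divergentClusters {d : ℕ} {Ω : Type*} [MeasurableSpace Ω] (P : Measure Ω)
    (X : Ω → EuclideanSpace ℝ (Fin d)) (u : ℕ → ℝ) : Finset (Finset (Fin d)) :=
  Finset.univ.filter fun β => β.Nonempty ∧
    Tendsto (fun n => level P X n (u n) * pPre P X (u n) β) atTop atTop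

/-- The vector `√k • Diag(w_S)^(-1/2) (T_S / k - c_S)`, indexed by the clusters of `S`, with the
power of the diagonal matrix taken componentwise. -/
noncomputable def normalizedVector {d : ℕ} (S : Finset (Finset (Fin d))) (k : ℝ)
    (w T c : Finset (Fin d) → ℝ) : EuclideanSpace ℝ S :=
  WithLp.toLp 2 fun β : S => √k * ((√(w β))⁻¹ * (T β / k - c β))

end SparseRV

namespace SparseRV

lemma tendsto_mul_exp_sub_one_sub_id {q a : ℕ → ℝ} {v : ℝ}
    (ha : Tendsto a atTop (𝓝 0))
    (hv : Tendsto (fun n : ℕ => n * q n * a n ^ 2) atTop (𝓝 v)) :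
    Tendsto (fun n : ℕ => (n : ℂ) * ((q n : ℂ) * (Complex.exp (a n * Complex.I) - 1
      - a n * Complex.I))) atTop (𝓝 (-(v : ℂ) / 2)) := by
  have hmain : Tendsto (fun n : ℕ => -((n * q n * a n ^ 2 : ℝ) : ℂ) / 2) atTop
      (𝓝 (-(v : ℂ) / 2)) :=
    (((Complex.continuous_ofReal.tendsto v).comp hv).neg).div_const 2
  have hbound : Tendsto (fun n : ℕ => |n * q n * a n ^ 2| * (|a n| * Real.exp |a n|)) atTop
      (𝓝 0) := by
    have h := hv.abs.mul (ha.abs.mul ((Real.continuous_exp.tendsto _).comp ha.abs))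
    simpa using h
  have herr : Tendsto (fun n : ℕ => (n : ℂ) * ((q n : ℂ) * (Complex.exp (a n * Complex.I) - 1
      - a n * Complex.I)) - -((n * q n * a n ^ 2 : ℝ) : ℂ) / 2) atTop (𝓝 0) := by
    refine squeeze_zero_norm (fun n => ?_) hbound
    have h3 := Complex.norm_exp_sub_sum_le_norm_mul_exp (a n * Complex.I) 3
    have e : (n : ℂ) * ((q n : ℂ) * (Complex.exp (a n * Complex.I) - 1
        - a n * Complex.I)) - -((n * q n * a n ^ 2 : ℝ) : ℂ) / 2
        = ((n * q n : ℝ) : ℂ) * (Complex.exp (a n * Complex.I)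
          - ∑ m ∈ Finset.range 3, (a n * Complex.I) ^ m / m.factorial) := by
      simp only [Finset.sum_range_succ, Finset.sum_range_zero, Nat.factorial]
      push_cast
      ring_nf
      simp only [Complex.I_sq]
      ring
    rw [e, norm_mul, Complex.norm_real, Real.norm_eq_abs]
    have hn : ‖(a n : ℂ) * Complex.I‖ = |a n| := by simp
    rw [hn] at h3
    calc |n * q n| * _ ≤ |n * q n| * (|a n| ^ 3 * Real.exp |a n|) := by gcongr
      _ = _ := by rw [abs_mul (n * q n), abs_of_nonneg (sq_nonneg (a n)), ← sq_abs]; ring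
  simpa using herr.add hmain

/-- Convergence of the characteristic functions of centred multinomial sums with rare cells. -/
lemma tendsto_multinomial_charFun {ι : Type*} [Fintype ι] {q a : ι → ℕ → ℝ} {v : ι → ℝ}
    (hq0 : ∀ i n, 0 ≤ q i n) (hq : ∀ i, Tendsto (q i) atTop (𝓝 0))
    (ha : ∀ i, Tendsto (a i) atTop (𝓝 0))
    (hv : ∀ i, Tendsto (fun n : ℕ => n * q i n * a i n ^ 2) atTop (𝓝 (v i))) :
    Tendsto (fun n : ℕ => (Complex.exp (-((∑ i, q i n * a i n : ℝ) * Complex.I)) *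
      (1 + ∑ i, (q i n : ℂ) * (Complex.exp (a i n * Complex.I) - 1))) ^ n) atTop
      (𝓝 (Complex.exp (-((∑ i, v i : ℝ) : ℂ) / 2))) := by
  set m : ℕ → ℝ := fun n => ∑ i, q i n * a i n with hm
  set W : ℕ → ℂ := fun n => ∑ i, (q i n : ℂ) * (Complex.exp (a i n * Complex.I) - 1) with hW
  set M : ℕ → ℝ := fun n => ∑ i, q i n * |a i n| with hM
  have hM0 : ∀ n, 0 ≤ M n := fun n =>
    Finset.sum_nonneg fun i _ => mul_nonneg (hq0 i n) (abs_nonneg _)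
  have hmM : ∀ n, |m n| ≤ M n := fun n => by
    refine (Finset.abs_sum_le_sum_abs _ _).trans (Finset.sum_le_sum fun i _ => ?_)
    rw [abs_mul, abs_of_nonneg (hq0 i n)]
  have hWM : ∀ n, ‖W n‖ ≤ M n := fun n => by
    refine (norm_sum_le _ _).trans (Finset.sum_le_sum fun i _ => ?_)
    rw [norm_mul, Complex.norm_real, Real.norm_of_nonneg (hq0 i n), mul_comm (a i n : ℂ)]
    exact mul_le_mul_of_nonneg_left (Real.norm_exp_I_mul_ofReal_sub_one_le) (hq0 i n)
  have hMlim : Tendsto M atTop (𝓝 0) := by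
    have h := tendsto_finsetSum (Finset.univ : Finset ι)
      fun i _ => (hq i).mul (ha i).abs
    simpa using h
  have hMsq : Tendsto (fun n : ℕ => n * M n ^ 2) atTop (𝓝 0) := by
    have h := (tendsto_finsetSum (Finset.univ : Finset ι) fun i _ => hq i).mul
      (tendsto_finsetSum (Finset.univ : Finset ι) fun i _ => hv i)
    simp only [Finset.sum_const_zero, zero_mul] at h
    refine squeeze_zero (fun n => by positivity) (fun n => ?_) h
    have hcs := Finset.sum_sq_le_sum_mul_sum_of_sq_le_mul (Finset.univ : Finset ι)
      (r := fun i => q i n * |a i n|) (f := fun i => q i n) (g := fun i => q i n * a i n ^ 2)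
      (fun i _ => hq0 i n) (fun i _ => mul_nonneg (hq0 i n) (sq_nonneg _))
      (fun i _ => le_of_eq (by rw [mul_pow, sq_abs]; ring))
    calc (n : ℝ) * M n ^ 2 ≤ n * ((∑ i, q i n) * ∑ i, q i n * a i n ^ 2) := by gcongr
      _ = _ := by
        rw [mul_left_comm, Finset.mul_sum (Finset.univ) (fun i => q i n * a i n ^ 2)]
        simp only [mul_assoc]
  have hlin : Tendsto (fun n : ℕ => (n : ℂ) * (W n - m n * Complex.I)) atTop
      (𝓝 (-((∑ i, v i : ℝ) : ℂ) / 2)) := by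
    have h := tendsto_finsetSum (Finset.univ : Finset ι)
      fun i _ => tendsto_mul_exp_sub_one_sub_id (ha i) (hv i)
    convert h using 2 with n
    · rw [← Finset.mul_sum]
      simp only [hW, hm, Complex.ofReal_sum, Finset.sum_mul, ← Finset.sum_sub_distrib]
      congr 1
      refine Finset.sum_congr rfl fun i _ => ?_
      push_cast
      ring
    · push_cast
      rw [← Finset.sum_div, Finset.sum_neg_distrib]
  have herr : Tendsto (fun n : ℕ => (n : ℂ) * ((Complex.exp (-(m n * Complex.I)) * (1 + W n) - 1)
      - (W n - m n * Complex.I))) atTop (𝓝 0) := by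
    refine squeeze_zero_norm' (a := fun n : ℕ => 3 * (n * M n ^ 2)) ?_
      (by simpa using hMsq.const_mul 3)
    filter_upwards [hMlim.eventually (ge_mem_nhds (zero_lt_one' ℝ))] with n hn
    have hz : ‖-((m n : ℂ) * Complex.I)‖ = |m n| := by simp
    have h2 := Complex.norm_exp_sub_one_sub_id_le (x := -(m n * Complex.I))
      (by rw [hz]; exact (hmM n).trans hn)
    rw [hz] at h2
    have e : (Complex.exp (-(m n * Complex.I)) * (1 + W n) - 1) - (W n - m n * Complex.I)
        = (Complex.exp (-(m n * Complex.I)) - 1 - -(m n * Complex.I)) * (1 + W n)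
          + -(m n * Complex.I) * W n := by ring
    have h1W : ‖1 + W n‖ ≤ 2 :=
      (norm_add_le _ _).trans (by rw [norm_one]; linarith [hWM n])
    have hm2 : |m n| ^ 2 ≤ M n ^ 2 := by gcongr; exact hmM n
    rw [norm_mul, Complex.norm_natCast, e]
    calc (n : ℝ) * _ ≤ n * (M n ^ 2 * 2 + M n * M n) := by
          gcongr
          refine (norm_add_le _ _).trans ?_
          rw [norm_mul, norm_mul, hz]
          gcongr
          · exact h2.trans hm2
          · exact hM0 n
          · exact hmM n
          · exact hWM n
      _ = _ := by ring
  have hfin := Complex.tendsto_one_add_pow_exp_of_tendsto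
    (g := fun n => Complex.exp (-(m n * Complex.I)) * (1 + W n) - 1)
    (t := -((∑ i, v i : ℝ) : ℂ) / 2) (by
      have := herr.add hlin
      rw [zero_add] at this
      refine this.congr fun n => ?_
      ring)
  refine hfin.congr fun n => ?_
  rw [add_sub_cancel]

/-- The characteristic function of a step function of a random variable, with disjoint steps. -/
lemma charFun_map_sum_indicator {Ω E ι : Type*} [MeasurableSpace Ω] [MeasurableSpace E]
    [Fintype ι] (P : Measure Ω) [IsProbabilityMeasure P] {X : Ω → E} (hX : Measurable X)
    {A : ι → Set E} (hA : ∀ i, MeasurableSet (A i)) (hdisj : Pairwise fun i j => Disjoint (A i) (A j))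
    (a : ι → ℝ) :
    charFun (P.map fun ω => ∑ i, a i * (A i).indicator (fun _ => (1 : ℝ)) (X ω)) 1 =
      1 + ∑ i, (P.real (X ⁻¹' A i) : ℂ) * (Complex.exp (a i * Complex.I) - 1) := by
  have hmeas : Measurable fun ω => ∑ i, a i * (A i).indicator (fun _ => (1 : ℝ)) (X ω) :=
    Finset.measurable_fun_sum _ fun i _ =>
      ((measurable_const.indicator (hA i)).comp hX).const_mul _
  rw [charFun_apply_real, integral_map hmeas.aemeasurable (by fun_prop)]
  have hpt : ∀ x, Complex.exp ((1 : ℝ) * (∑ i, a i * (A i).indicator (fun _ => (1 : ℝ)) x : ℝ)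
      * Complex.I) = 1 + ∑ i, (A i).indicator
        (fun _ => Complex.exp (a i * Complex.I) - 1) x := by
    intro x
    by_cases h : ∃ i, x ∈ A i
    · obtain ⟨i, hi⟩ := h
      have hne : ∀ j, j ≠ i → x ∉ A j := fun j hj hxj =>
        Set.disjoint_left.1 (hdisj hj) hxj hi
      rw [Finset.sum_eq_single i (fun j _ hj => by simp [hne j hj]) (by simp),
        Finset.sum_eq_single i (fun j _ hj => by simp [hne j hj]) (by simp)]
      simp [hi]
    · push Not at h
      simp [h]
  simp_rw [hpt]
  have hint : ∀ i, Integrable (fun ω => (A i).indicator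
      (fun _ => Complex.exp (a i * Complex.I) - 1) (X ω)) P := fun i =>
    ((integrable_const (Complex.exp (a i * Complex.I) - 1)).indicator (hX (hA i)))
  rw [integral_add (integrable_const _) (integrable_finsetSum _ fun i _ => hint i),
    integral_finsetSum _ fun i _ => hint i]
  congr 1
  · simp
  · refine Finset.sum_congr rfl fun i _ => ?_
    have : (fun ω => (A i).indicator (fun _ => Complex.exp (a i * Complex.I) - 1) (X ω))
        = (X ⁻¹' A i).indicator fun _ => Complex.exp (a i * Complex.I) - 1 := rfl
    rw [this, integral_indicator_const _ (hX (hA i))]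
    simp

lemma IsSimplexProj.inner_le_zero {d : ℕ} {x y w : EuclideanSpace ℝ (Fin d)}
    (h : IsSimplexProj x y) (hw : w ∈ simplex d) : inner ℝ (x - y) (w - y) ≤ 0 := by
  have : Nonempty (simplex d) := ⟨⟨y, h.1⟩⟩
  refine (norm_eq_iInf_iff_real_inner_le_zero (convex_simplex d) h.1).1 ?_ w hw
  exact le_antisymm (le_ciInf fun w => h.2 w w.2)
    (ciInf_le (f := fun w : simplex d => ‖x - w‖)
      ⟨0, Set.forall_mem_range.2 fun _ => norm_nonneg _⟩ ⟨y, h.1⟩)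

lemma IsSimplexProj.norm_sub_le {d : ℕ} {x y x' y' : EuclideanSpace ℝ (Fin d)}
    (h : IsSimplexProj x y) (h' : IsSimplexProj x' y') : ‖y - y'‖ ≤ ‖x - x'‖ := by
  have h1 := h.inner_le_zero h'.1
  have h2 := h'.inner_le_zero h.1
  have e : inner ℝ (x - x') (y - y') = ‖y - y'‖ ^ 2
      - inner ℝ (x - y) (y' - y) - inner ℝ (x' - y') (y - y') := by
    rw [← real_inner_self_eq_norm_sq, ← neg_sub y y', inner_neg_right, sub_neg_eq_add,
      ← inner_add_left, ← inner_sub_left]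
    congr 1
    abel
  have h3 := real_inner_le_norm (x - x') (y - y')
  by_contra! hlt
  nlinarith [norm_nonneg (x - x')]

/-- The optimality conditions for the projection onto the simplex. -/
lemma IsSimplexProj.sub_le_sub {d : ℕ} {x y : EuclideanSpace ℝ (Fin d)}
    (h : IsSimplexProj x y) {i : Fin d} (hi : 0 < y i) (j : Fin d) :
    x j - y j ≤ x i - y i := by
  rcases eq_or_ne j i with rfl | hij
  · exact le_rfl
  set w : EuclideanSpace ℝ (Fin d) :=
    y + (EuclideanSpace.single j (y i) - EuclideanSpace.single i (y i)) with hw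
  have hmem : w ∈ simplex d := by
    refine ⟨fun l => ?_, ?_⟩
    · by_cases hl : l = i
      · subst hl; simp [hw, hij.symm]
      · by_cases hl' : l = j
        · subst hl'; simpa [hw, hl] using add_nonneg (h.1.1 l) hi.le
        · simpa [hw, hl, hl'] using h.1.1 l
    · simp [hw, Finset.sum_add_distrib, Finset.sum_sub_distrib, h.1.2]
  have h1 := h.inner_le_zero hmem
  rw [hw, add_sub_cancel_left, inner_sub_right] at h1
  simp only [EuclideanSpace.inner_single_right, PiLp.sub_apply, conj_trivial] at h1
  nlinarith

/-- Cells which are empty for the projection of `s⁻¹ • x` up to a small error are empty for the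
projection of `x`. -/
lemma IsSimplexProj.eq_zero_of_lt {d : ℕ} {x y z : EuclideanSpace ℝ (Fin d)} {s : ℝ} (hs : 1 < s)
    (h : IsSimplexProj x y) (h' : IsSimplexProj (s⁻¹ • x) z) {i : Fin d}
    (hi : s * z i ≤ (s - 1) / d) : y i = 0 := by
  by_contra hne
  have hyi : 0 < y i := lt_of_le_of_ne (h.1.1 i) (Ne.symm hne)
  have hd : (0 : ℝ) < d := by exact_mod_cast i.pos
  have hs0 : 0 < s := by linarith
  have hsum : ∑ _j : Fin d, (s - 1) / d ≤ ∑ j, (s * z j - y j) := by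
    rw [Finset.sum_sub_distrib, ← Finset.mul_sum, h.1.2, h'.1.2]
    simp only [Finset.sum_const, Finset.card_univ, Fintype.card_fin, nsmul_eq_mul]
    rw [mul_div_cancel₀ _ hd.ne']
    linarith
  obtain ⟨j, -, hj⟩ := Finset.exists_le_of_sum_le ⟨i, Finset.mem_univ i⟩ hsum
  have hzj : 0 < z j := by
    have h1 : 0 < (s - 1) / d := div_pos (by linarith) hd
    have h2 := h.1.1 j
    exact pos_of_mul_pos_right (by linarith : 0 < s * z j) hs0.le
  have h1 := h.sub_le_sub hyi j
  have h2 := h'.sub_le_sub hzj i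
  simp only [PiLp.smul_apply, smul_eq_mul] at h2
  have h3 := mul_le_mul_of_nonneg_left h2 hs0.le
  rw [mul_sub, mul_sub, ← mul_assoc, ← mul_assoc, mul_inv_cancel₀ hs0.ne', one_mul, one_mul] at h3
  linarith

lemma continuous_simplexProj {d : ℕ} :
    Continuous (simplexProj : EuclideanSpace ℝ (Fin d) → EuclideanSpace ℝ (Fin d)) := by
  rcases Nat.eq_zero_or_pos d with rfl | hd
  · exact continuous_of_const fun _ _ => Subsingleton.elim _ _
  · refine (LipschitzWith.of_dist_le_mul (K := 1) fun x y => ?_).continuous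
    rw [dist_eq_norm, dist_eq_norm, NNReal.coe_one, one_mul]
    exact (simplexProj_spec hd x).norm_sub_le (simplexProj_spec hd y)

lemma continuous_l1Norm {d : ℕ} : Continuous (l1Norm : EuclideanSpace ℝ (Fin d) → ℝ) := by
  unfold l1Norm
  fun_prop

lemma measurableSet_cone {d : ℕ} (β : Finset (Fin d)) : MeasurableSet (cone β) := by
  have h : cone β = simplex d ∩ ((⋂ i ∈ β, {x : EuclideanSpace ℝ (Fin d) | 0 < x i}) ∩
      ⋂ i ∈ βᶜ, {x : EuclideanSpace ℝ (Fin d) | x i = 0}) := by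
    ext x; simp [cone]; tauto
  rw [h]
  refine (isClosed_simplex d).measurableSet.inter (MeasurableSet.inter ?_ ?_)
  · exact Finset.measurableSet_biInter _ fun i _ =>
      (isOpen_lt continuous_const (by fun_prop)).measurableSet
  · exact Finset.measurableSet_biInter _ fun i _ =>
      (isClosed_eq (by fun_prop) continuous_const).measurableSet

lemma disjoint_cone {d : ℕ} {β γ : Finset (Fin d)} (h : β ≠ γ) :
    Disjoint (cone β) (cone γ) := by
  rw [Set.disjoint_left]
  intro x hβ hγ
  refine h (Finset.ext fun i => ⟨fun hi => ?_, fun hi => ?_⟩)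
  · by_contra hn
    exact (hβ.2.1 i hi).ne' (hγ.2.2 i hn)
  · by_contra hn
    exact (hγ.2.1 i hi).ne' (hβ.2.2 i hn)

/-- The points whose projection at level `u` lies in `C_β` and whose norm exceeds `u`. -/
def exceedanceCell {d : ℕ} (u : ℝ) (β : Finset (Fin d)) : Set (EuclideanSpace ℝ (Fin d)) :=
  {x | simplexProj (u⁻¹ • x) ∈ cone β ∧ u < l1Norm x}

lemma measurableSet_lt_l1Norm {d : ℕ} (u : ℝ) :
    MeasurableSet {x : EuclideanSpace ℝ (Fin d) | u < l1Norm x} :=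
  (isOpen_lt continuous_const continuous_l1Norm).measurableSet

lemma measurable_simplexProj_smul {d : ℕ} (u : ℝ) :
    Measurable fun x : EuclideanSpace ℝ (Fin d) => simplexProj (u⁻¹ • x) :=
  (continuous_simplexProj.comp (continuous_const_smul u⁻¹)).measurable

lemma measurableSet_exceedanceCell {d : ℕ} (u : ℝ) (β : Finset (Fin d)) :
    MeasurableSet (exceedanceCell u β) :=
  ((measurable_simplexProj_smul u) (measurableSet_cone β)).inter (measurableSet_lt_l1Norm u)

lemma clusterCount_eq_sum {d : ℕ} {Ω : Type*} (Xs : ℕ → Ω → EuclideanSpace ℝ (Fin d)) (n : ℕ)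
    (u : ℝ) (β : Finset (Fin d)) (ω : Ω) :
    (clusterCount Xs n u β ω : ℝ) =
      ∑ j ∈ Finset.range n, (exceedanceCell u β).indicator (fun _ => (1 : ℝ)) (Xs j ω) := by
  classical
  rw [clusterCount, Finset.card_filter]
  push_cast
  refine Finset.sum_congr rfl fun j _ => ?_
  simp only [Set.indicator_apply, exceedanceCell, Set.mem_ofPred_eq]

lemma measureReal_exceedanceCell {d : ℕ} {Ω : Type*} [MeasurableSpace Ω] (P : Measure Ω)
    [IsProbabilityMeasure P] {X : Ω → EuclideanSpace ℝ (Fin d)} (hX : Measurable X) (u : ℝ)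
    (β : Finset (Fin d)) :
    P.real (X ⁻¹' exceedanceCell u β) = P.real {ω | u < l1Norm (X ω)} * pPre P X u β := by
  have h := cond_mul_eq_inter (hX (measurableSet_lt_l1Norm u))
    {ω | simplexProj (u⁻¹ • X ω) ∈ cone β} P
  have h' := congrArg ENNReal.toReal h
  rw [ENNReal.toReal_mul] at h'
  rw [pPre, Measure.real, Measure.real, Measure.real, mul_comm]
  refine Eq.trans ?_ h'.symm
  congr 2
  ext ω
  simp [exceedanceCell, and_comm]

lemma measurable_clusterCount {d : ℕ} {Ω : Type*} [MeasurableSpace Ω]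
    {Xs : ℕ → Ω → EuclideanSpace ℝ (Fin d)} (hXs : ∀ j, Measurable (Xs j)) (n : ℕ)
    (u : ℝ) (β : Finset (Fin d)) :
    Measurable fun ω => (clusterCount Xs n u β ω : ℝ) := by
  simp_rw [clusterCount_eq_sum]
  exact Finset.measurable_fun_sum _ fun j _ =>
    (measurable_const.indicator (measurableSet_exceedanceCell u β)).comp (hXs j)

lemma measurable_normalizedVector {d : ℕ} {Ω : Type*} [MeasurableSpace Ω]
    {Xs : ℕ → Ω → EuclideanSpace ℝ (Fin d)} (hXs : ∀ j, Measurable (Xs j)) (n : ℕ)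
    (u k : ℝ) (S : Finset (Finset (Fin d))) (w c : Finset (Fin d) → ℝ) :
    Measurable fun ω => normalizedVector S k w (fun β => clusterCount Xs n u β ω) c := by
  unfold normalizedVector
  refine (PiLp.continuous_toLp 2 _).measurable.comp (measurable_pi_lambda _ fun β => ?_)
  exact ((((measurable_clusterCount hXs n u β).div_const k).sub_const _).const_mul _).const_mul _

/-- The characteristic function of the normalized vector of cluster counts. -/
lemma charFun_normalizedVector {d : ℕ} {Ω : Type*} [MeasurableSpace Ω]
    (P : Measure Ω) [IsProbabilityMeasure P]
    {X : Ω → EuclideanSpace ℝ (Fin d)} (hX : Measurable X)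
    {Xs : ℕ → Ω → EuclideanSpace ℝ (Fin d)} (hXs : ∀ j, Measurable (Xs j))
    (hindep : iIndepFun Xs P) (hident : ∀ j, IdentDistrib (Xs j) X P P)
    (n : ℕ) (u k : ℝ) (S : Finset (Finset (Fin d))) (w c : Finset (Fin d) → ℝ)
    (ξ : EuclideanSpace ℝ S) :
    charFun (P.map fun ω => normalizedVector S k w (fun β => clusterCount Xs n u β ω) c) ξ =
      (1 + ∑ β : S, (P.real (X ⁻¹' exceedanceCell u β) : ℂ) *
        (Complex.exp (((ξ β * (√k * (√(w β))⁻¹ / k) : ℝ) : ℂ) * Complex.I) - 1)) ^ n *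
      Complex.exp (-((∑ β : S, ξ β * (√k * (√(w β))⁻¹ * c β) : ℝ) * Complex.I)) := by
  set a : S → ℝ := fun β => ξ β * (√k * (√(w β))⁻¹ / k) with ha
  set b : ℝ := ∑ β : S, ξ β * (√k * (√(w β))⁻¹ * c β) with hb
  set G : EuclideanSpace ℝ (Fin d) → ℝ := fun x =>
    ∑ β : S, a β * (exceedanceCell u β.1).indicator (fun _ => (1 : ℝ)) x with hG
  have hGm : Measurable G := Finset.measurable_fun_sum _ fun β _ =>
    (measurable_const.indicator (measurableSet_exceedanceCell u β.1)).const_mul _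
  have hinner : ∀ ω, inner ℝ (normalizedVector S k w (fun β => clusterCount Xs n u β ω) c) ξ
      = ∑ j ∈ Finset.range n, G (Xs j ω) - b := by
    intro ω
    simp only [normalizedVector, PiLp.inner_apply, hG, hb]
    rw [Finset.sum_comm, ← Finset.sum_sub_distrib]
    refine Finset.sum_congr rfl fun β _ => ?_
    rw [← Finset.mul_sum, ← clusterCount_eq_sum]
    simp only [RCLike.inner_apply, conj_trivial, ha]
    ring
  have hstep : charFun (P.map fun ω => G (X ω)) 1 = _ :=
    charFun_map_sum_indicator P hX (fun β : S => measurableSet_exceedanceCell u β.1)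
      (fun β γ h => by
        refine Set.disjoint_left.2 fun x hx hx' => ?_
        exact Set.disjoint_left.1 (disjoint_cone fun e => h (Subtype.ext e)) hx.1 hx'.1) a
  have hsum : charFun (P.map fun ω => ∑ j ∈ Finset.range n, G (Xs j ω)) 1
      = charFun (P.map fun ω => G (X ω)) 1 ^ n := by
    have hi : iIndepFun (fun j ω => G (Xs j ω)) P := hindep.comp (fun _ => G) fun _ => hGm
    have hm : ∀ j ∈ Finset.range n, AEMeasurable (fun ω => G (Xs j ω)) P :=
      fun j _ => (hGm.comp (hXs j)).aemeasurable
    rw [(hi.restrict _).charFun_map_fun_finsetSum_eq_prod hm, Finset.prod_apply,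
      Finset.prod_congr rfl (g := fun _ => charFun (P.map fun ω => G (X ω)) 1)
        (fun j _ => by
          have := ((hident j).comp hGm).map_eq
          exact congrArg (fun μ => charFun μ 1) this), Finset.prod_const, Finset.card_range]
  have hSm : Measurable fun ω => ∑ j ∈ Finset.range n, G (Xs j ω) :=
    Finset.measurable_fun_sum _ fun j _ => hGm.comp (hXs j)
  rw [← hstep, ← hsum, charFun_apply, charFun_apply_real,
    integral_map (measurable_normalizedVector hXs n u k S w c).aemeasurable (by fun_prop),
    integral_map hSm.aemeasurable (by fun_prop), ← integral_mul_const]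
  refine integral_congr_ae (Eventually.of_forall fun ω => ?_)
  simp only [hinner]
  rw [← Complex.exp_add]
  congr 1
  push_cast
  ring

/-- Asymptotic normality of cluster counts, for general weights and centring. -/
theorem tendstoInDistribution_normalizedVector {d : ℕ} {Ω : Type*} [MeasurableSpace Ω]
    (P : Measure Ω) [IsProbabilityMeasure P]
    {X : Ω → EuclideanSpace ℝ (Fin d)} (hX : Measurable X)
    {Xs : ℕ → Ω → EuclideanSpace ℝ (Fin d)} (hXs : ∀ j, Measurable (Xs j))
    (hindep : iIndepFun Xs P) (hident : ∀ j, IdentDistrib (Xs j) X P P)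
    {u : ℕ → ℝ} (hk : Tendsto (fun n => level P X n (u n)) atTop atTop)
    (hrare : Tendsto (fun n => P.real {ω | u n < l1Norm (X ω)}) atTop (𝓝 0))
    (S : Finset (Finset (Fin d))) (w c : ℕ → Finset (Fin d) → ℝ)
    (hkw : ∀ β ∈ S, Tendsto (fun n => level P X n (u n) * w n β) atTop atTop)
    (hpw : ∀ β ∈ S, Tendsto (fun n => pPre P X (u n) β / w n β) atTop (𝓝 1))
    (hc : ∀ β ∈ S, Tendsto (fun n => √(level P X n (u n)) *
      ((√(w n β))⁻¹ * (pPre P X (u n) β - c n β))) atTop (𝓝 0)) :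
    TendstoInDistribution
      (fun n ω => normalizedVector S (level P X n (u n)) (w n)
        (fun β => clusterCount Xs n (u n) β ω) (c n))
      atTop id (fun _ => P) (multivariateGaussian (0 : EuclideanSpace ℝ S) 1) where
  forall_aemeasurable n := (measurable_normalizedVector hXs n _ _ S _ _).aemeasurable
  aemeasurable_limit := aemeasurable_id
  tendsto := by
    refine ProbabilityMeasure.tendsto_iff_tendsto_charFun.2 fun ξ => ?_
    simp only [ProbabilityMeasure.coe_mk, Measure.map_id]
    rw [charFun_multivariateGaussian Matrix.PosSemidef.one]
    simp only [charFun_normalizedVector P hX hXs hindep hident]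
    set k : ℕ → ℝ := fun n => level P X n (u n) with hkdef
    set q : S → ℕ → ℝ := fun β n => P.real (X ⁻¹' exceedanceCell (u n) β.1) with hqdef
    set a : S → ℕ → ℝ := fun β n => ξ β * (√(k n) * (√(w n β))⁻¹ / k n) with hadef
    have hq0 : ∀ β n, 0 ≤ q β n := fun β n => measureReal_nonneg
    have hnq : ∀ β (n : ℕ), (n : ℝ) * q β n = k n * pPre P X (u n) β.1 := fun β n => by
      simp only [hqdef, hkdef, measureReal_exceedanceCell P hX, level]
      ring
    have hq : ∀ β, Tendsto (q β) atTop (𝓝 0) := fun β =>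
      squeeze_zero (hq0 β) (fun n => measureReal_mono fun ω h => h.2) hrare
    have hkw' : ∀ β : S, ∀ᶠ n in atTop, 0 < k n ∧ 0 < w n β := fun β => by
      filter_upwards [hk.eventually_gt_atTop 0, (hkw β β.2).eventually_gt_atTop 0] with n h1 h2
      exact ⟨h1, pos_of_mul_pos_right h2 h1.le⟩
    have haeq : ∀ β : S, ∀ᶠ n in atTop, a β n = ξ β * (√(k n * w n β))⁻¹ := fun β => by
      filter_upwards [hkw' β] with n hn
      simp only [hadef]
      rw [Real.sqrt_mul hn.1.le, mul_inv]
      congr 1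
      rw [mul_div_right_comm, Real.sqrt_div_self]
    have ha : ∀ β, Tendsto (a β) atTop (𝓝 0) := fun β => by
      have h := (tendsto_inv_atTop_zero.comp
        (Real.tendsto_sqrt_atTop.comp (hkw β β.2))).const_mul (ξ β)
      rw [mul_zero] at h
      exact h.congr' ((haeq β).mono fun n hn => hn.symm)
    have hv : ∀ β, Tendsto (fun n : ℕ => n * q β n * a β n ^ 2) atTop (𝓝 (ξ β ^ 2)) := fun β => by
      have h := (hpw β β.2).const_mul (ξ β ^ 2)
      rw [mul_one] at h
      refine h.congr' ?_
      filter_upwards [hkw' β, haeq β] with n hn hn'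
      have h1 := hn.1
      have h2 := hn.2
      rw [hnq, hn', mul_pow, inv_pow, Real.sq_sqrt (mul_nonneg h1.le h2.le)]
      field_simp
    have hmain := tendsto_multinomial_charFun hq0 hq ha hv
    have hphase : Tendsto (fun n => Complex.exp ((∑ β : S, ξ β * (√(k n) *
        ((√(w n β))⁻¹ * (pPre P X (u n) β - c n β))) : ℝ) * Complex.I)) atTop (𝓝 1) := by
      have h := tendsto_finsetSum (Finset.univ : Finset S)
        fun β _ => (hc β β.2).const_mul (ξ β)
      simp only [mul_zero, Finset.sum_const_zero] at h
      have hcont : Continuous fun x : ℝ => Complex.exp (x * Complex.I) := by fun_prop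
      have h' := (hcont.tendsto 0).comp h
      simp only [Complex.ofReal_zero, zero_mul, Complex.exp_zero] at h'
      exact h'
    have hprod := hmain.mul hphase
    rw [mul_one] at hprod
    convert hprod.congr' ?_ using 2
    · congr 1
      simp only [inner_zero_right, Matrix.one_mulVec, dotProduct]
      push_cast
      simp only [zero_mul, zero_sub, neg_div]
      congr 3
      ext β
      ring
    · filter_upwards [hk.eventually_gt_atTop 0] with n hn
      rw [mul_pow, ← Complex.exp_nat_mul, mul_comm (Complex.exp _), mul_assoc, ← Complex.exp_add]
      congr 2
      have hb : (n : ℝ) * (∑ β, q β n * a β n) = ∑ β : S, ξ β * (√(k n) *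
          ((√(w n β))⁻¹ * pPre P X (u n) β)) := by
        rw [Finset.mul_sum]
        refine Finset.sum_congr rfl fun β _ => ?_
        rw [← mul_assoc, hnq]
        simp only [hadef]
        have : k n ≠ 0 := hn.ne'
        field_simp
      have hb' : (n : ℂ) * -(((∑ β, q β n * a β n : ℝ) : ℂ) * Complex.I)
          = -(((n : ℝ) * (∑ β, q β n * a β n) : ℝ) : ℂ) * Complex.I := by
        push_cast
        ring
      rw [hb', hb, ← neg_mul, ← add_mul, ← Complex.ofReal_neg, ← Complex.ofReal_add,
        ← Complex.ofReal_neg]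
      congr 2
      rw [← Finset.sum_neg_distrib, ← Finset.sum_neg_distrib, ← Finset.sum_add_distrib]
      refine Finset.sum_congr rfl fun β _ => ?_
      ring

lemma integral_le_measureReal {Ω : Type*} [MeasurableSpace Ω] (μ : Measure Ω) [IsFiniteMeasure μ]
    {f : Ω → ℝ} (hf : Measurable f) (h0 : ∀ ω, 0 ≤ f ω) (h1 : ∀ ω, f ω ≤ 1) {B : Set Ω}
    (hB : MeasurableSet B) (h : ∀ ω ∉ B, f ω = 0) : ∫ ω, f ω ∂μ ≤ μ.real B := by
  rw [← integral_indicator_one hB]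
  refine integral_mono (Integrable.of_bound hf.aestronglyMeasurable 1
    (Eventually.of_forall fun ω => by rw [Real.norm_of_nonneg (h0 ω)]; exact h1 ω))
    ((integrable_const 1).indicator hB) fun ω => ?_
  by_cases hω : ω ∈ B
  · simpa [hω] using h1 ω
  · simp [hω, h ω hω]

lemma measureReal_le_integral {Ω : Type*} [MeasurableSpace Ω] (μ : Measure Ω) [IsFiniteMeasure μ]
    {f : Ω → ℝ} (hf : Measurable f) (h0 : ∀ ω, 0 ≤ f ω) (h1 : ∀ ω, f ω ≤ 1) {B : Set Ω}
    (hB : MeasurableSet B) (h : ∀ ω ∈ B, f ω = 1) : μ.real B ≤ ∫ ω, f ω ∂μ := by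
  rw [← integral_indicator_one hB]
  refine integral_mono ((integrable_const 1).indicator hB)
    (Integrable.of_bound hf.aestronglyMeasurable 1
    (Eventually.of_forall fun ω => by rw [Real.norm_of_nonneg (h0 ω)]; exact h1 ω)) fun ω => ?_
  by_cases hω : ω ∈ B
  · simp [hω, h ω hω]
  · simpa [hω] using h0 ω

/-- The linear subspace of the vectors vanishing outside `β`. -/
def zeroOff {d : ℕ} (β : Finset (Fin d)) : Set (EuclideanSpace ℝ (Fin d)) :=
  {z | ∀ i ∉ β, z i = 0}

lemma measurableSet_zeroOff {d : ℕ} (β : Finset (Fin d)) : MeasurableSet (zeroOff β) := by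
  have h : zeroOff β = ⋂ i ∈ βᶜ, {x : EuclideanSpace ℝ (Fin d) | x i = 0} := by
    ext x; simp [zeroOff]
  rw [h]
  exact Finset.measurableSet_biInter _ fun i _ =>
    (isClosed_eq (by fun_prop) continuous_const).measurableSet

/-- On the simplex, the points vanishing outside `β` are partitioned by the `C_γ`, `γ ⊆ β`. -/
lemma measureReal_zeroOff {d : ℕ} {Ω : Type*} [MeasurableSpace Ω] (μ : Measure Ω)
    [IsFiniteMeasure μ] {W : Ω → EuclideanSpace ℝ (Fin d)} (hW : Measurable W)
    (hmem : ∀ᵐ ω ∂μ, W ω ∈ simplex d) (β : Finset (Fin d)) :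
    μ.real {ω | W ω ∈ zeroOff β} = ∑ γ ∈ β.powerset, μ.real {ω | W ω ∈ cone γ} := by
  classical
  rw [← measureReal_biUnion_finset]
  · refine measureReal_congr ?_
    filter_upwards [hmem] with ω hω
    refine propext ⟨fun h => ?_, fun h => ?_⟩
    · refine Set.mem_iUnion₂.2 ⟨Finset.univ.filter fun i => 0 < W ω i, ?_, ?_⟩
      · rw [Finset.mem_powerset]
        intro i hi
        by_contra hn
        exact (Finset.mem_filter.1 hi).2.ne' (h i hn)
      · refine ⟨hω, fun i hi => (Finset.mem_filter.1 hi).2, fun i hi => ?_⟩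
        have : ¬ 0 < W ω i := fun h => hi (Finset.mem_filter.2 ⟨Finset.mem_univ _, h⟩)
        exact le_antisymm (not_lt.1 this) (hω.1 i)
    · obtain ⟨γ, hγ, h'⟩ := Set.mem_iUnion₂.1 h
      exact fun i hi => h'.2.2 i fun hi' => hi (Finset.mem_powerset.1 hγ hi')
  · intro γ _ γ' _ hne
    exact Set.disjoint_left.2 fun ω h h' => Set.disjoint_left.1 (disjoint_cone hne) h h'
  · exact fun γ _ => hW (measurableSet_cone γ)

/-- A continuous approximation of the indicator function of `zeroOff β`. -/
noncomputable def offBump {d : ℕ} (β : Finset (Fin d)) (ε : ℝ) (z : EuclideanSpace ℝ (Fin d)) : ℝ :=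
  max 0 (1 - ε⁻¹ * ∑ i ∈ βᶜ, |z i|)

/-- A continuous function which vanishes for `y ≤ s` and is `1` for `y ≥ 2 * s - 1`. -/
noncomputable def ramp (s y : ℝ) : ℝ := max 0 (min 1 ((y - s) / (s - 1)))

lemma continuous_offBump {d : ℕ} (β : Finset (Fin d)) (ε : ℝ) : Continuous (offBump β ε) := by
  unfold offBump
  fun_prop

lemma continuous_ramp (s : ℝ) : Continuous (ramp s) := by
  unfold ramp
  fun_prop

lemma offBump_nonneg {d : ℕ} (β : Finset (Fin d)) (ε : ℝ) (z) : 0 ≤ offBump β ε z :=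
  le_max_left _ _

lemma offBump_le_one {d : ℕ} (β : Finset (Fin d)) {ε : ℝ} (hε : 0 < ε) (z) :
    offBump β ε z ≤ 1 :=
  max_le zero_le_one (sub_le_self _ (mul_nonneg (inv_nonneg.2 hε.le)
    (Finset.sum_nonneg fun _ _ => abs_nonneg _)))

lemma offBump_of_mem {d : ℕ} {β : Finset (Fin d)} {ε : ℝ} {z} (hz : z ∈ zeroOff β) :
    offBump β ε z = 1 := by
  have : ∑ i ∈ βᶜ, |z i| = 0 :=
    Finset.sum_eq_zero fun i hi => by rw [hz i (Finset.mem_compl.1 hi), abs_zero]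
  simp [offBump, this]

lemma lt_of_offBump_ne_zero {d : ℕ} {β : Finset (Fin d)} {ε : ℝ} (hε : 0 < ε)
    {z : EuclideanSpace ℝ (Fin d)} (hz : offBump β ε z ≠ 0) {i : Fin d} (hi : i ∉ β) :
    z i < ε := by
  by_contra! h
  refine hz (max_eq_left ?_)
  have h1 : |z i| ≤ ∑ i ∈ βᶜ, |z i| :=
    Finset.single_le_sum (f := fun i => |z i|) (fun _ _ => abs_nonneg _) (Finset.mem_compl.2 hi)
  have h2 : ε ≤ ∑ i ∈ βᶜ, |z i| := h.trans ((le_abs_self _).trans h1)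
  have h3 : ε⁻¹ * ε ≤ ε⁻¹ * ∑ i ∈ βᶜ, |z i| := mul_le_mul_of_nonneg_left h2 (inv_nonneg.2 hε.le)
  rw [inv_mul_cancel₀ hε.ne'] at h3
  linarith

lemma tendsto_offBump {d : ℕ} (β : Finset (Fin d)) (z : EuclideanSpace ℝ (Fin d)) :
    Tendsto (fun n : ℕ => offBump β (1 / ((n : ℝ) + 1)) z) atTop
      (𝓝 ((zeroOff β).indicator (fun _ => 1) z)) := by
  by_cases hz : z ∈ zeroOff β
  · simp [hz, offBump_of_mem hz]
  · rw [Set.indicator_of_notMem hz]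
    have : ∃ i, i ∉ β ∧ z i ≠ 0 := by simpa [zeroOff] using hz
    obtain ⟨i, hi, hne⟩ := this
    have hpos : 0 < ∑ i ∈ βᶜ, |z i| :=
      (abs_pos.2 hne).trans_le (Finset.single_le_sum (f := fun i => |z i|)
        (fun _ _ => abs_nonneg _) (Finset.mem_compl.2 hi))
    have hlim := (tendsto_natCast_atTop_atTop (R := ℝ)).atTop_mul_const hpos
    refine tendsto_const_nhds.congr' ?_
    filter_upwards [hlim.eventually_ge_atTop 1] with n hn
    refine (max_eq_left ?_).symm
    rw [one_div, inv_inv]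
    nlinarith

lemma ramp_nonneg (s y : ℝ) : 0 ≤ ramp s y := le_max_left _ _

lemma ramp_le_one (s y : ℝ) : ramp s y ≤ 1 := max_le zero_le_one (min_le_left _ _)

lemma ramp_of_le {s y : ℝ} (hs : 1 < s) (h : y ≤ s) : ramp s y = 0 :=
  max_eq_left ((min_le_right _ _).trans
    (div_nonpos_of_nonpos_of_nonneg (by linarith) (by linarith)))

lemma ramp_of_ge {s y : ℝ} (hs : 1 < s) (h : 2 * s - 1 < y) : ramp s y = 1 := by
  have : 1 ≤ (y - s) / (s - 1) := (one_le_div (by linarith)).2 (by linarith)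
  simp [ramp, this]

section

variable {d : ℕ} {Ω Ω' : Type*} [MeasurableSpace Ω] [MeasurableSpace Ω']
  {P : Measure Ω} {Q : Measure Ω'}
  {X : Ω → EuclideanSpace ℝ (Fin d)} {Y : Ω' → ℝ} {Z : Ω' → EuclideanSpace ℝ (Fin d)} {α : ℝ}

lemma IsSparselyRegularlyVarying.tendsto_integral_angular
    (h : IsSparselyRegularlyVarying P X Q Y Z α)
    {g : EuclideanSpace ℝ (Fin d) → ℝ} (hg : Continuous g) {C : ℝ} (hC : ∀ z, ‖g z‖ ≤ C) :
    Tendsto (fun t : ℝ => ∫ ω, g (simplexProj (t⁻¹ • X ω)) ∂(P[|{ω | t < l1Norm (X ω)}]))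
      atTop (𝓝 (∫ ω, g (Z ω) ∂Q)) :=
  h.tendsto (BoundedContinuousFunction.ofNormedAddCommGroup (fun p => g p.2)
    (hg.comp continuous_snd) C fun p => hC p.2)

lemma IsSparselyRegularlyVarying.tendsto_integral_radial
    (h : IsSparselyRegularlyVarying P X Q Y Z α)
    {g : ℝ → ℝ} (hg : Continuous g) {C : ℝ} (hC : ∀ z, ‖g z‖ ≤ C) :
    Tendsto (fun t : ℝ => ∫ ω, g (l1Norm (X ω) / t) ∂(P[|{ω | t < l1Norm (X ω)}]))
      atTop (𝓝 (∫ ω, g (Y ω) ∂Q)) :=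
  h.tendsto (BoundedContinuousFunction.ofNormedAddCommGroup (fun p => g p.1)
    (hg.comp continuous_fst) C fun p => hC p.1)

lemma IsSparselyRegularlyVarying.pos_dim [IsProbabilityMeasure Q]
    (h : IsSparselyRegularlyVarying P X Q Y Z α) :
    0 < d := by
  obtain ⟨ω, hω⟩ := h.angular_mem.exists
  rcases Nat.eq_zero_or_pos d with rfl | hd
  · have := hω.2
    simp at this
  · exact hd

/-- Exceeding the higher level `s * t` and having an almost vanishing projection there forces a
vanishing projection at level `t`. -/
lemma integral_mul_integral_le_measureReal [IsFiniteMeasure P] (hd : 0 < d)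
    (hX : Measurable X) (β : Finset (Fin d)) {s t : ℝ} (hs : 1 < s) (ht : 0 < t) :
    (∫ ω, ramp s (l1Norm (X ω) / t) ∂(P[|{ω | t < l1Norm (X ω)}])) *
      (∫ ω, offBump β ((s - 1) / d / s) (simplexProj ((t * s)⁻¹ • X ω))
        ∂(P[|{ω | t * s < l1Norm (X ω)}])) ≤
      (P[|{ω | t < l1Norm (X ω)}]).real {ω | simplexProj (t⁻¹ • X ω) ∈ zeroOff β} := by
  have hd' : (0 : ℝ) < d := by exact_mod_cast hd
  have hs0 : 0 < s := by linarith
  have hε : 0 < (s - 1) / d / s := div_pos (div_pos (by linarith) hd') hs0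
  set ε := (s - 1) / d / s with hεdef
  have hmA : MeasurableSet {ω | t < l1Norm (X ω)} := hX (measurableSet_lt_l1Norm t)
  have hmB : MeasurableSet {ω | t * s < l1Norm (X ω)} := hX (measurableSet_lt_l1Norm _)
  have hbm : Measurable fun ω => offBump β ε (simplexProj ((t * s)⁻¹ • X ω)) :=
    (continuous_offBump β ε).measurable.comp ((measurable_simplexProj_smul _).comp hX)
  have hmC : MeasurableSet {ω | offBump β ε (simplexProj ((t * s)⁻¹ • X ω)) ≠ 0} :=
    hbm (measurableSet_singleton 0).compl
  set μ := P[|{ω | t < l1Norm (X ω)}] with hμ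
  have hcond : P[|{ω | t * s < l1Norm (X ω)}] = μ[|{ω | t * s < l1Norm (X ω)}] := by
    rw [hμ, cond_cond_eq_cond_inter hmA hmB]
    congr 1
    refine (Set.inter_eq_right.2 fun ω hω => ?_).symm
    have hω' : t * s < l1Norm (X ω) := hω
    show t < l1Norm (X ω)
    nlinarith
  have h1 : ∫ ω, ramp s (l1Norm (X ω) / t) ∂μ ≤ μ.real {ω | t * s < l1Norm (X ω)} := by
    refine integral_le_measureReal μ ((continuous_ramp s).measurable.comp
      ((continuous_l1Norm.measurable.comp hX).div_const t)) (fun ω => ramp_nonneg _ _)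
      (fun ω => ramp_le_one _ _) hmB fun ω hω => ramp_of_le hs ?_
    have hω' : ¬ t * s < l1Norm (X ω) := hω
    rw [div_le_iff₀ ht, mul_comm]
    exact not_lt.1 hω'
  have h2 := integral_le_measureReal (μ[|{ω | t * s < l1Norm (X ω)}]) hbm
    (fun ω => offBump_nonneg _ _ _) (fun ω => offBump_le_one β hε _) hmC
    (fun ω hω => not_not.1 hω)
  have h3 : (μ[|{ω | t * s < l1Norm (X ω)}]).real
      {ω | offBump β ε (simplexProj ((t * s)⁻¹ • X ω)) ≠ 0} * μ.real {ω | t * s < l1Norm (X ω)}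
      = μ.real ({ω | t * s < l1Norm (X ω)} ∩
        {ω | offBump β ε (simplexProj ((t * s)⁻¹ • X ω)) ≠ 0}) := by
    rw [Measure.real, Measure.real, ← ENNReal.toReal_mul, cond_mul_eq_inter hmB]
    rfl
  rw [hcond]
  calc _ ≤ μ.real {ω | t * s < l1Norm (X ω)} * _ :=
        mul_le_mul h1 h2 (integral_nonneg fun ω => offBump_nonneg _ _ _) measureReal_nonneg
    _ = _ := by rw [mul_comm, h3]
    _ ≤ _ := by
      refine measureReal_mono fun ω hω i hi => ?_
      have hz := lt_of_offBump_ne_zero hε hω.2 hi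
      have hproj := simplexProj_spec hd ((t * s)⁻¹ • X ω)
      have e : (t * s)⁻¹ • X ω = s⁻¹ • (t⁻¹ • X ω) := by rw [smul_smul, mul_inv, mul_comm]
      rw [e] at hz hproj
      refine (simplexProj_spec hd (t⁻¹ • X ω)).eq_zero_of_lt hs hproj ?_
      rw [hεdef, lt_div_iff₀ hs0] at hz
      linarith

/-- Convergence on the faces of the simplex, whose indicator functions are not continuous. -/
lemma IsSparselyRegularlyVarying.tendsto_zeroOff [IsFiniteMeasure P] [IsProbabilityMeasure Q]
    (h : IsSparselyRegularlyVarying P X Q Y Z α)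
    (hX : Measurable X) (β : Finset (Fin d)) :
    Tendsto (fun t : ℝ => (P[|{ω | t < l1Norm (X ω)}]).real
      {ω | simplexProj (t⁻¹ • X ω) ∈ zeroOff β}) atTop (𝓝 (Q.real {ω | Z ω ∈ zeroOff β})) := by
  have hd := h.pos_dim
  have hd' : (0 : ℝ) < d := by exact_mod_cast hd
  have hZm : MeasurableSet {ω | Z ω ∈ zeroOff β} := h.measurable_angular (measurableSet_zeroOff β)
  have hbound : ∀ ε : ℝ, 0 < ε → ∀ z : EuclideanSpace ℝ (Fin d), ‖offBump β ε z‖ ≤ 1 :=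
    fun ε hε z => by
      rw [Real.norm_of_nonneg (offBump_nonneg _ _ _)]
      exact offBump_le_one β hε z
  have hQle : ∀ ε : ℝ, 0 < ε → Q.real {ω | Z ω ∈ zeroOff β} ≤ ∫ ω, offBump β ε (Z ω) ∂Q :=
    fun ε hε => measureReal_le_integral Q
      ((continuous_offBump β ε).measurable.comp h.measurable_angular)
      (fun ω => offBump_nonneg _ _ _) (fun ω => offBump_le_one β hε _) hZm
      fun ω hω => offBump_of_mem hω
  refine tendsto_order.2 ⟨fun a ha => ?_, fun b hb => ?_⟩
  · have hcont : Tendsto (fun s : ℝ => (2 * s - 1) ^ (-α) * Q.real {ω | Z ω ∈ zeroOff β})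
        (𝓝[>] 1) (𝓝 (Q.real {ω | Z ω ∈ zeroOff β})) := by
      have h1 : ContinuousAt (fun s : ℝ => (2 * s - 1) ^ (-α)) 1 :=
        ContinuousAt.rpow_const (by fun_prop) (Or.inl (by norm_num))
      have h2 := (h1.tendsto.mono_left (nhdsWithin_le_nhds (s := Set.Ioi 1))).mul_const
        (Q.real {ω | Z ω ∈ zeroOff β})
      have e : (2 * (1 : ℝ) - 1) ^ (-α) = 1 := by norm_num
      rw [e, one_mul] at h2
      exact h2
    obtain ⟨s, hsa, hs⟩ := ((hcont.eventually (lt_mem_nhds ha)).and self_mem_nhdsWithin).exists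
    have hs1 : 1 < s := hs
    have hε : 0 < (s - 1) / d / s := div_pos (div_pos (by linarith) hd') (by linarith)
    have hY : (2 * s - 1) ^ (-α) ≤ ∫ ω, ramp s (Y ω) ∂Q := by
      rw [← h.pareto (2 * s - 1) (by linarith)]
      exact measureReal_le_integral Q ((continuous_ramp s).measurable.comp h.measurable_radial)
        (fun ω => ramp_nonneg _ _) (fun ω => ramp_le_one _ _)
        (h.measurable_radial measurableSet_Ioi) fun ω hω => ramp_of_ge hs1 hω
    have hlim := (h.tendsto_integral_radial (continuous_ramp s) (C := 1) fun y => by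
        rw [Real.norm_of_nonneg (ramp_nonneg _ _)]; exact ramp_le_one _ _).mul
      ((h.tendsto_integral_angular (continuous_offBump β _) (hbound _ hε)).comp
        (tendsto_id.atTop_mul_const (by linarith : 0 < s)))
    have hlt : a < (∫ ω, ramp s (Y ω) ∂Q) * ∫ ω, offBump β ((s - 1) / d / s) (Z ω) ∂Q :=
      hsa.trans_le (mul_le_mul hY (hQle _ hε) measureReal_nonneg
        (integral_nonneg fun ω => ramp_nonneg _ _))
    filter_upwards [hlim.eventually (lt_mem_nhds hlt), eventually_gt_atTop 0] with t ht ht0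
    exact ht.trans_le (integral_mul_integral_le_measureReal hd hX β hs1 ht0)
  · have hdom : Tendsto (fun n : ℕ => ∫ ω, offBump β (1 / ((n : ℝ) + 1)) (Z ω) ∂Q) atTop
        (𝓝 (Q.real {ω | Z ω ∈ zeroOff β})) := by
      have e : Q.real {ω | Z ω ∈ zeroOff β}
          = ∫ ω, (zeroOff β).indicator (fun _ => (1 : ℝ)) (Z ω) ∂Q :=
        (integral_indicator_one hZm).symm
      rw [e]
      refine tendsto_integral_of_dominated_convergence (fun _ => 1) (fun n =>
        ((continuous_offBump β _).measurable.comp h.measurable_angular).aestronglyMeasurable)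
        (integrable_const 1) (fun n => Eventually.of_forall fun ω => ?_)
        (Eventually.of_forall fun ω => tendsto_offBump β (Z ω))
      exact hbound _ (by positivity) _
    obtain ⟨n, hn⟩ := (hdom.eventually (gt_mem_nhds hb)).exists
    have hε : (0 : ℝ) < 1 / ((n : ℝ) + 1) := by positivity
    filter_upwards [(h.tendsto_integral_angular (continuous_offBump β _) (hbound _ hε)).eventually
      (gt_mem_nhds hn)] with t ht
    refine lt_of_le_of_lt ?_ ht
    have hm := (measurable_simplexProj_smul t).comp hX
    exact measureReal_le_integral _ ((continuous_offBump β _).measurable.comp hm)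
      (fun ω => offBump_nonneg _ _ _) (fun ω => offBump_le_one β hε _)
      (hm (measurableSet_zeroOff β)) fun ω hω => offBump_of_mem hω

/-- The pre-asymptotic cluster probabilities converge to the limiting ones. -/
theorem IsSparselyRegularlyVarying.tendsto_pPre [IsFiniteMeasure P]
    [IsProbabilityMeasure Q] (h : IsSparselyRegularlyVarying P X Q Y Z α)
    (hX : Measurable X) (β : Finset (Fin d)) :
    Tendsto (fun t : ℝ => pPre P X t β) atTop (𝓝 (pStar Q Z β)) := by
  classical
  induction β using Finset.strongInduction with
  | H β ih =>
    have hP : ∀ t, pPre P X t β = (P[|{ω | t < l1Norm (X ω)}]).real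
        {ω | simplexProj (t⁻¹ • X ω) ∈ zeroOff β} - ∑ γ ∈ β.powerset.erase β, pPre P X t γ :=
      fun t => by
        have hm : Measurable fun ω => simplexProj (t⁻¹ • X ω) :=
          (measurable_simplexProj_smul t).comp hX
        rw [measureReal_zeroOff _ hm
          (Eventually.of_forall fun ω => (simplexProj_spec h.pos_dim _).1)]
        exact eq_sub_of_add_eq (Finset.add_sum_erase _ _ (Finset.mem_powerset_self β))
    have hQ : pStar Q Z β = Q.real {ω | Z ω ∈ zeroOff β}
        - ∑ γ ∈ β.powerset.erase β, pStar Q Z γ := by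
      rw [measureReal_zeroOff Q h.measurable_angular h.angular_mem]
      exact eq_sub_of_add_eq (Finset.add_sum_erase _ _ (Finset.mem_powerset_self β))
    simp_rw [hP]
    rw [hQ]
    refine (h.tendsto_zeroOff hX β).sub (tendsto_finsetSum _ fun γ hγ => ih γ ?_)
    rw [Finset.mem_erase, Finset.mem_powerset] at hγ
    exact Finset.ssubset_iff_subset_ne.2 ⟨hγ.2, hγ.1⟩

end

lemma tendsto_measureReal_lt_atTop {Ω : Type*} [MeasurableSpace Ω] (P : Measure Ω)
    [IsFiniteMeasure P] {f : Ω → ℝ} (hf : Measurable f) :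
    Tendsto (fun t : ℝ => P.real {ω | t < f ω}) atTop (𝓝 0) := by
  have hdom := tendsto_integral_filter_of_dominated_convergence (μ := P) (l := (atTop : Filter ℝ))
    (F := fun t => Set.indicator {ω | t < f ω} fun _ => (1 : ℝ)) (f := fun _ => (0 : ℝ))
    (fun _ => 1) (Eventually.of_forall fun t =>
      (measurable_const.indicator (measurableSet_lt measurable_const hf)).aestronglyMeasurable)
    (Eventually.of_forall fun t => Eventually.of_forall fun ω =>
      (norm_indicator_le_norm_self (fun _ => (1 : ℝ)) ω).trans norm_one.le) (integrable_const 1)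
    (Eventually.of_forall fun ω => tendsto_const_nhds.congr' (by
      filter_upwards [eventually_ge_atTop (f ω)] with t ht
      have hn : ω ∉ {ω | t < f ω} := not_lt.2 ht
      exact (Set.indicator_of_notMem hn _).symm))
  rw [integral_zero] at hdom
  refine hdom.congr fun t => ?_
  exact integral_indicator_one (measurableSet_lt measurable_const hf)

lemma pos_of_mem_extremalClusters {d : ℕ} {Ω' : Type*} [MeasurableSpace Ω'] {Q : Measure Ω'}
    {Z : Ω' → EuclideanSpace ℝ (Fin d)} {β : Finset (Fin d)} (h : β ∈ extremalClusters Q Z) :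
    0 < pStar Q Z β := by
  rw [extremalClusters, Finset.mem_filter] at h
  exact h.2.2

lemma tendsto_of_mem_divergentClusters {d : ℕ} {Ω : Type*} [MeasurableSpace Ω] {P : Measure Ω}
    {X : Ω → EuclideanSpace ℝ (Fin d)} {u : ℕ → ℝ} {β : Finset (Fin d)}
    (h : β ∈ divergentClusters P X u) :
    Tendsto (fun n => level P X n (u n) * pPre P X (u n) β) atTop atTop := by
  classical
  simp only [divergentClusters, Finset.mem_filter] at h
  exact h.2.2

end SparseRV

theorem mainTheorem1 {d : ℕ} {Ω Ω' : Type*} [MeasurableSpace Ω] [MeasurableSpace Ω']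
    (P : Measure Ω) [IsProbabilityMeasure P] (Q : Measure Ω') [IsProbabilityMeasure Q]
    (X : Ω → EuclideanSpace ℝ (Fin d)) (hX : Measurable X)
    (hX_nonneg : ∀ᵐ ω ∂P, ∀ i, 0 ≤ X ω i)
    (Y : Ω' → ℝ) (Z : Ω' → EuclideanSpace ℝ (Fin d)) (α : ℝ)
    (hsrv : SparseRV.IsSparselyRegularlyVarying P X Q Y Z α)
    (Xs : ℕ → Ω → EuclideanSpace ℝ (Fin d)) (hXs : ∀ j, Measurable (Xs j))
    (hindep : iIndepFun Xs P) (hident : ∀ j, IdentDistrib (Xs j) X P P)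
    (u : ℕ → ℝ) (hu_pos : ∀ n, 0 < u n) (hu : Tendsto u atTop atTop)
    (hk : Tendsto (fun n => SparseRV.level P X n (u n)) atTop atTop) :
    TendstoInDistribution
      (fun n ω => SparseRV.normalizedVector (SparseRV.divergentClusters P X u)
        (SparseRV.level P X n (u n)) (SparseRV.pPre P X (u n))
        (fun β => SparseRV.clusterCount Xs n (u n) β ω) (SparseRV.pPre P X (u n)))
      atTop id (fun _ => P)
      (multivariateGaussian (0 : EuclideanSpace ℝ (SparseRV.divergentClusters P X u)) 1) ∧
    TendstoInDistribution
      (fun n ω => SparseRV.normalizedVector (SparseRV.extremalClusters Q Z)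
        (SparseRV.level P X n (u n)) (SparseRV.pStar Q Z)
        (fun β => SparseRV.clusterCount Xs n (u n) β ω) (SparseRV.pPre P X (u n)))
      atTop id (fun _ => P)
      (multivariateGaussian (0 : EuclideanSpace ℝ (SparseRV.extremalClusters Q Z)) 1) ∧
    ((∀ β ∈ SparseRV.extremalClusters Q Z,
        Tendsto (fun n => √(SparseRV.level P X n (u n)) *
          (SparseRV.pPre P X (u n) β - SparseRV.pStar Q Z β)) atTop (𝓝 0)) →
      TendstoInDistribution
        (fun n ω => SparseRV.normalizedVector (SparseRV.extremalClusters Q Z)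
          (SparseRV.level P X n (u n)) (SparseRV.pStar Q Z)
          (fun β => SparseRV.clusterCount Xs n (u n) β ω) (SparseRV.pStar Q Z))
        atTop id (fun _ => P)
        (multivariateGaussian (0 : EuclideanSpace ℝ (SparseRV.extremalClusters Q Z)) 1)) := by
  have hrare : Tendsto (fun n => P.real {ω | u n < SparseRV.l1Norm (X ω)}) atTop (𝓝 0) :=
    (SparseRV.tendsto_measureReal_lt_atTop P (SparseRV.continuous_l1Norm.measurable.comp hX)).comp
      hu
  have hstar : ∀ β ∈ SparseRV.extremalClusters Q Z, 0 < SparseRV.pStar Q Z β :=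
    fun _ hβ => SparseRV.pos_of_mem_extremalClusters hβ
  have hkw : ∀ β ∈ SparseRV.extremalClusters Q Z,
      Tendsto (fun n => SparseRV.level P X n (u n) * SparseRV.pStar Q Z β) atTop atTop :=
    fun β hβ => hk.atTop_mul_const (hstar β hβ)
  have hpw : ∀ β ∈ SparseRV.extremalClusters Q Z,
      Tendsto (fun n => SparseRV.pPre P X (u n) β / SparseRV.pStar Q Z β) atTop (𝓝 1) := by
    intro β hβ
    have h := ((hsrv.tendsto_pPre hX β).comp hu).div_const (SparseRV.pStar Q Z β)
    rwa [div_self (hstar β hβ).ne'] at h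
  refine ⟨?_, ?_, fun hbias => ?_⟩
  · have hdiv : ∀ β ∈ SparseRV.divergentClusters P X u,
        Tendsto (fun n => SparseRV.level P X n (u n) * SparseRV.pPre P X (u n) β) atTop atTop :=
      fun _ hβ => SparseRV.tendsto_of_mem_divergentClusters hβ
    refine SparseRV.tendstoInDistribution_normalizedVector P hX hXs hindep hident hk hrare _
      (fun n => SparseRV.pPre P X (u n)) (fun n => SparseRV.pPre P X (u n)) hdiv
      (fun β hβ => ?_) (fun β _ => by simp)
    refine tendsto_const_nhds.congr' ?_
    filter_upwards [(hdiv β hβ).eventually_gt_atTop 0] with n hn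
    exact (div_self (right_ne_zero_of_mul hn.ne')).symm
  · exact SparseRV.tendstoInDistribution_normalizedVector P hX hXs hindep hident hk hrare _
      (fun _ => SparseRV.pStar Q Z) (fun n => SparseRV.pPre P X (u n)) hkw hpw
      (fun β _ => by simp)
  · refine SparseRV.tendstoInDistribution_normalizedVector P hX hXs hindep hident hk hrare _
      (fun _ => SparseRV.pStar Q Z) (fun _ => SparseRV.pStar Q Z) hkw hpw (fun β hβ => ?_)
    have h := (hbias β hβ).const_mul (√(SparseRV.pStar Q Z β))⁻¹
    rw [mul_zero] at h
    exact h.congr fun n => mul_left_comm _ _ _
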